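/- **Definitions.** A *BY forest* $T=(T,S,\epsilon F)$ consists of a finite graph-theoretic forest $T$ with an edge-length function $l\colon E(T)\to\mathbb N=\{1,2,3,\dots\}$, a subgraph $S\subseteq T$, a length-preserving graph automorphism $F$ of $T$ with $F(S)=S$, and a sign function $\epsilon\colon\pi_0(T\setminus S)\to\{\pm1\}$, where $T\setminus S$ is the complement in the underlying topological space of $T$. Let $\Lambda_T=\mathrm H_1(T,S,\mathbb Z)$ be the relative homology lattice, with the positive-definite intersection length pairing: $\langle\gamma,\gamma'\rangle$ is the sum, over the edges $a$ of $T$ not in $S$, of $l(a)$ times the product of the multiplicities with which $\gamma$ and $\gamma'$ traverse $a$ (with respect to a fixed orientation of $a$). The signed automorphism $\epsilon F$ acts isometrically on $\Lambda_T$ by sending the class of a path $\gamma$ contained in the closure of a component $C$ of $T\setminus S$ to $\epsilon(C)[F\gamma]$. It therefore acts on the finite group $\Lambda_T^\vee/\Lambda_T$, where $\Lambda_T^\vee=\mathrm{Hom}(\Lambda_T,\mathbb Z)$ and $\Lambda_T\hookrightarrow\Lambda_T^\vee$ is induced by the pairing. The *Tamagawa number* of $T$ is $$c_T:=\#\left(\Lambda_T^\vee/\Lambda_T\right)^{\epsilon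 F}.$$ The *parity conditions* on $T$ are: * (A) if two vertices of $T$ (in the same component) lie an odd distance apart, then at least one of them is either a leaf (degree $1$ vertex) that is in $S$ and whose incident edge is not in $S$; or of degree $2$ and not in $S$; or of degree $2$, in $S$, and with both incident edges in $S$; * (B) no iterate of $F$ inverts any edge of $T$ of odd length. For $e\in\mathbb N$, let $T_{e,1}=(eT,eS,\epsilon F)$ denote the BY forest obtained from $T$ by multiplying all edge lengths by $e$ (and keeping the graph, the subgraph, the automorphism and the signs). **Proposition.** Let $T=(T,S,\epsilon F)$ be a BY forest satisfying parity conditions (A) and (B). Then all the BY forests $T_{e,1}$, $e\in\mathbb N$, also satisfy (A) and (B), and there are constants $a\in\mathbb N$, $r\in\mathbb N_0$ and $s\in\mathbb Z$ (depending only on $T$) such that for all $e\in\mathbb N$ $$c_{T_{e,1}}=a\,e^r\,(e,2)^s,$$ where $(e,2)$ denotes the highest common factor of $e$ and $2$. -/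

import Mathlib

noncomputable section

section Complement

variable {V : Type*} {G : SimpleGraph V} (S : G.Subgraph)

/-- The open cells of the topological complement of a subgraph `S` of a graph `G`: the vertices
not in `S` and the open edges not in `S`. -/
def ComplementCell : Type _ :=
  {v : V // v ∉ S.verts} ⊕ {a : Sym2 V // a ∈ G.edgeSet ∧ a ∉ S.edgeSet}

/-- A vertex outside `S` is incident to an open edge outside `S`. -/
def ComplementIncident : ComplementCell S → ComplementCell S → Prop
  | Sum.inl v, Sum.inr a => v.1 ∈ a.1
  | _, _ => False

/-- The set of connected components of the topological space `G ∖ S`: cells modulo the equivalence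
relation generated by incidence. -/
def ComplementComponents : Type _ := Quot (ComplementIncident S)

end Complement

/-- A pair `(T, S)` of an integrally metrised graph-theoretic forest `T` with vertex set `V`
and a subgraph `S` of `T`. -/
structure MetrisedForestPair (V : Type*) where
  graph : SimpleGraph V
  acyclic : graph.IsAcyclic
  length : graph.edgeSet → ℕ+
  S : graph.Subgraph

namespace MetrisedForestPair

variable {V : Type*} (P : MetrisedForestPair V)

/-- The component of `T ∖ S` containing a vertex not in `S`. -/
def vertexComponent (v : V) (hv : v ∉ P.S.verts) : ComplementComponents P.S :=
  Quot.mk _ (Sum.inl ⟨v, hv⟩)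

/-- The component of `T ∖ S` containing the open edge `uv` not in `S`. -/
def edgeComponent (u v : V) (h : P.graph.Adj u v ∧ ¬ P.S.Adj u v) : ComplementComponents P.S :=
  Quot.mk _ (Sum.inr ⟨s(u, v), h⟩)

theorem edgeComponent_eq_vertexComponent (u v : V) (h : P.graph.Adj u v ∧ ¬ P.S.Adj u v)
    (hv : v ∉ P.S.verts) : P.edgeComponent u v h = P.vertexComponent v hv := by
  refine (Quot.sound ?_).symm
  change v ∈ s(u, v)
  simp

theorem edgeComponent_swap (u v : V) (h : P.graph.Adj u v ∧ ¬ P.S.Adj u v)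
    (h' : P.graph.Adj v u ∧ ¬ P.S.Adj v u) :
    P.edgeComponent u v h = P.edgeComponent v u h' := by
  unfold edgeComponent
  congr 2
  exact Subtype.ext Sym2.eq_swap

/-- The length of a walk in `T`. In a forest two vertices of the same component are joined by exactly
one path, whose length is their distance. -/
def walkLength {u v : V} (p : P.graph.Walk u v) : ℕ :=
  (p.darts.map fun d => (P.length ⟨d.edge, d.edge_mem⟩ : ℕ)).sum

/-- The group `C₁(T, S; ℤ)` of relative `1`-chains: alternating functions on the oriented edges of `T`
that vanish on the edges in `S`. The value `c u v` is the coefficient of the edge oriented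
from `u` to `v`. -/
def relChains : Submodule ℤ (V → V → ℤ) where
  carrier := {c | (∀ u v, c v u = - c u v) ∧
    ∀ u v, ¬ (P.graph.Adj u v ∧ ¬ P.S.Adj u v) → c u v = 0}
  add_mem' := by
    rintro a b ⟨ha, ha'⟩ ⟨hb, hb'⟩
    refine ⟨fun u v => ?_, fun u v h => ?_⟩
    · simp only [Pi.add_apply, ha u v, hb u v]; ring
    · simp only [Pi.add_apply, ha' u v h, hb' u v h, add_zero]
  zero_mem' := by simp
  smul_mem' := by
    rintro n a ⟨ha, ha'⟩
    refine ⟨fun u v => ?_, fun u v h => ?_⟩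
    · simp only [Pi.smul_apply, ha u v, smul_eq_mul]; ring
    · simp only [Pi.smul_apply, ha' u v h, smul_zero]

variable [Fintype V]

/-- The boundary map from `C₁(T, S; ℤ)` to `C₀(T, S; ℤ)`, the latter being the free `ℤ`-module on the
vertices of `T` outside `S`. -/
def boundary : P.relChains →ₗ[ℤ] ({v : V // v ∉ P.S.verts} → ℤ) where
  toFun c v := ∑ u, c.1 u v.1
  map_add' a b := by
    funext v
    simp [Finset.sum_add_distrib]
  map_smul' n a := by
    funext v
    simp [Finset.mul_sum]

/-- The relative homology lattice `Λ = H₁(T, S; ℤ)`. There are no `2`-chains, so it is the group of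
relative `1`-cycles. -/
def homologyLattice : Submodule ℤ P.relChains := LinearMap.ker P.boundary

/-- The product of the coefficients of two chains at an unoriented edge. -/
def edgeProduct (c c' : P.relChains) : Sym2 V → ℤ :=
  Sym2.lift ⟨fun u v => c.1 u v * c'.1 u v, fun u v => by
    dsimp only
    rw [c.2.1 u v, c'.2.1 u v]; ring⟩

open scoped Classical in
/-- The length pairing on chains: the sum over the edges of `T` of the length times the product
of the coefficients. -/
def chainPairing : P.relChains →ₗ[ℤ] P.relChains →ₗ[ℤ] ℤ :=
  LinearMap.mk₂ ℤ
    (fun c c' => ∑ a : P.graph.edgeSet, ((P.length a : ℕ) : ℤ) * P.edgeProduct c c' a.1)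
    (fun a b c => by
      rw [← Finset.sum_add_distrib]
      refine Finset.sum_congr rfl fun ⟨x, hx⟩ _ => ?_
      induction x using Sym2.ind with | _ u v => simp [edgeProduct]; ring)
    (fun n a c => by
      rw [smul_eq_mul, Finset.mul_sum]
      refine Finset.sum_congr rfl fun ⟨x, hx⟩ _ => ?_
      induction x using Sym2.ind with | _ u v => simp [edgeProduct]; ring)
    (fun a b c => by
      rw [← Finset.sum_add_distrib]
      refine Finset.sum_congr rfl fun ⟨x, hx⟩ _ => ?_
      induction x using Sym2.ind with | _ u v => simp [edgeProduct]; ring)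
    (fun n a c => by
      rw [smul_eq_mul, Finset.mul_sum]
      refine Finset.sum_congr rfl fun ⟨x, hx⟩ _ => ?_
      induction x using Sym2.ind with | _ u v => simp [edgeProduct]; ring)

/-- The map from `Λ` to its dual `Λ^∨ = Hom(Λ, ℤ)` induced by the intersection length pairing. -/
def toDual : P.homologyLattice →ₗ[ℤ] Module.Dual ℤ P.homologyLattice :=
  P.chainPairing.domRestrict₁₂ P.homologyLattice P.homologyLattice

/-- The geometric Néron component group `Λ^∨ / Λ`. -/
abbrev GeometricComponentGroup : Type _ :=
  Module.Dual ℤ P.homologyLattice ⧸ LinearMap.range P.toDual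

end MetrisedForestPair

/-- A BY forest `(T, S, εF)`: an integrally metrised forest `T` on the vertex set `V` with a
subgraph `S`, an isometric automorphism `F` of `T` fixing `S` setwise, and a sign function `ε` on the
set of connected components of `T ∖ S`. -/
structure BYForest (V : Type*) extends MetrisedForestPair V where
  F : graph ≃g graph
  isometric : ∀ a : graph.edgeSet, length (F.mapEdgeSet a) = length a
  mem_verts : ∀ v, F v ∈ S.verts ↔ v ∈ S.verts
  adj_iff : ∀ u v, S.Adj (F u) (F v) ↔ S.Adj u v
  sign : ComplementComponents S → ℤˣ

namespace BYForest

variable {V : Type*} (T : BYForest V)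

/-- The BY forest obtained by multiplying all edge lengths by `e`. -/
def scale (e : ℕ+) : BYForest V where
  graph := T.graph
  acyclic := T.acyclic
  length a := e * T.length a
  S := T.S
  F := T.F
  isometric a := by rw [T.isometric]
  mem_verts := T.mem_verts
  adj_iff := T.adj_iff
  sign := T.sign

/-- The vertices admitted in parity condition (A): leaves in `S` with incident edge not in `S`;
vertices of degree `2` not in `S`; vertices of degree `2` in the interior of `S`. -/
def IsExceptional (v : V) : Prop :=
  ((T.graph.neighborSet v).ncard = 1 ∧ v ∈ T.S.verts ∧
    ∀ w, T.graph.Adj v w → ¬ T.S.Adj v w) ∨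
  ((T.graph.neighborSet v).ncard = 2 ∧ v ∉ T.S.verts) ∨
  ((T.graph.neighborSet v).ncard = 2 ∧ v ∈ T.S.verts ∧
    ∀ w, T.graph.Adj v w → T.S.Adj v w)

/-- Parity condition (A). -/
def ParityA : Prop :=
  ∀ (u v : V) (p : T.graph.Walk u v), p.IsPath → Odd (T.walkLength p) →
    T.IsExceptional u ∨ T.IsExceptional v

/-- Parity condition (B): no iterate of `F` inverts an edge of odd length. -/
def ParityB : Prop :=
  ∀ (n : ℕ) (u v : V) (h : T.graph.Adj u v), Odd (T.length ⟨s(u, v), h⟩ : ℕ) →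
    ¬ (T.F^[n] u = v ∧ T.F^[n] v = u)

open scoped Classical in
/-- The sign `ε(C)` of the component `C` of `T ∖ S` containing the open edge `uv`
(and `1` if `uv` is not an edge outside `S`, where chains vanish). -/
def edgeSign (u v : V) : ℤˣ :=
  if h : T.graph.Adj u v ∧ ¬ T.S.Adj u v then T.sign (T.edgeComponent u v h) else 1

theorem edgeSign_swap (u v : V) : T.edgeSign v u = T.edgeSign u v := by
  unfold edgeSign
  by_cases h : T.graph.Adj u v ∧ ¬ T.S.Adj u v
  · have h' : T.graph.Adj v u ∧ ¬ T.S.Adj v u := ⟨h.1.symm, fun h2 => h.2 h2.symm⟩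
    rw [dif_pos h, dif_pos h', T.edgeComponent_swap v u h' h]
  · have h' : ¬ (T.graph.Adj v u ∧ ¬ T.S.Adj v u) :=
      fun h' => h ⟨h'.1.symm, fun h2 => h'.2 h2.symm⟩
    rw [dif_neg h, dif_neg h']

theorem edge_iff (u v : V) : (T.graph.Adj (T.F u) (T.F v) ∧ ¬ T.S.Adj (T.F u) (T.F v)) ↔
    (T.graph.Adj u v ∧ ¬ T.S.Adj u v) := by
  rw [T.adj_iff, T.F.map_adj_iff]

theorem edge_symm_iff (u v : V) :
    (T.graph.Adj (T.F.symm u) (T.F.symm v) ∧ ¬ T.S.Adj (T.F.symm u) (T.F.symm v)) ↔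
    (T.graph.Adj u v ∧ ¬ T.S.Adj u v) := by
  have h := T.edge_iff (T.F.symm u) (T.F.symm v)
  simpa using h.symm

/-- The action of `εF` on relative chains: an oriented edge `uv` in the closure of a
component `C` of `T ∖ S` is sent to `ε(C)` times the oriented edge `F(u)F(v)`. -/
def chainAction : T.relChains ≃ₗ[ℤ] T.relChains where
  toFun c := ⟨fun u v => (T.edgeSign (T.F.symm u) (T.F.symm v) : ℤ) *
      c.1 (T.F.symm u) (T.F.symm v), by
    refine ⟨fun u v => ?_, fun u v h => ?_⟩
    · dsimp only
      rw [T.edgeSign_swap, c.2.1]; ring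
    · dsimp only
      rw [c.2.2 _ _ (fun h' => h ((T.edge_symm_iff u v).1 h')), mul_zero]⟩
  invFun c := ⟨fun u v => (T.edgeSign u v : ℤ) * c.1 (T.F u) (T.F v), by
    refine ⟨fun u v => ?_, fun u v h => ?_⟩
    · dsimp only
      rw [T.edgeSign_swap, c.2.1]; ring
    · dsimp only
      rw [c.2.2 _ _ (fun h' => h ((T.edge_iff u v).1 h')), mul_zero]⟩
  map_add' a b := by
    ext u v
    simp [mul_add]
  map_smul' n a := by
    ext u v
    simp; ring
  left_inv c := by
    ext u v
    simp [← mul_assoc, ← Units.val_mul]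
  right_inv c := by
    ext u v
    simp [← mul_assoc, ← Units.val_mul]

theorem chainAction_apply (c : T.relChains) (u v : V) :
    (T.chainAction c).1 u v = (T.edgeSign (T.F.symm u) (T.F.symm v) : ℤ) *
      c.1 (T.F.symm u) (T.F.symm v) := rfl

theorem chainAction_symm_apply (c : T.relChains) (u v : V) :
    (T.chainAction.symm c).1 u v = (T.edgeSign u v : ℤ) * c.1 (T.F u) (T.F v) := rfl

theorem edgeSign_mul (u v : V) (hv : v ∉ T.S.verts) (x : ℤ)
    (hx : ¬ (T.graph.Adj u v ∧ ¬ T.S.Adj u v) → x = 0) :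
    (T.edgeSign u v : ℤ) * x = (T.sign (T.vertexComponent v hv) : ℤ) * x := by
  by_cases h : T.graph.Adj u v ∧ ¬ T.S.Adj u v
  · rw [edgeSign, dif_pos h, T.edgeComponent_eq_vertexComponent u v h hv]
  · rw [hx h, mul_zero, mul_zero]

variable [Fintype V]

theorem chainAction_mem (c : T.relChains) (hc : c ∈ T.homologyLattice) :
    T.chainAction c ∈ T.homologyLattice := by
  rw [MetrisedForestPair.homologyLattice, LinearMap.mem_ker] at hc ⊢
  funext v
  have hv : T.F.symm v.1 ∉ T.S.verts := fun h => v.2 (by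
    simpa using (T.mem_verts (T.F.symm v.1)).2 h)
  have h0 : ∑ u, c.1 u (T.F.symm v.1) = 0 := congrFun hc ⟨_, hv⟩
  change ∑ u, (T.chainAction c).1 u v.1 = 0
  simp only [chainAction_apply]
  refine (T.F.symm.toEquiv.sum_comp (fun w => (T.edgeSign w (T.F.symm v.1) : ℤ) *
    c.1 w (T.F.symm v.1))).trans ?_
  rw [Finset.sum_congr rfl fun w _ => T.edgeSign_mul w _ hv _ (c.2.2 _ _), ← Finset.mul_sum, h0,
    mul_zero]

theorem chainAction_symm_mem (c : T.relChains) (hc : c ∈ T.homologyLattice) :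
    T.chainAction.symm c ∈ T.homologyLattice := by
  rw [MetrisedForestPair.homologyLattice, LinearMap.mem_ker] at hc ⊢
  funext v
  have hv : T.F v.1 ∉ T.S.verts := fun h => v.2 ((T.mem_verts v.1).1 h)
  have h0 : ∑ u, c.1 u (T.F v.1) = 0 := congrFun hc ⟨_, hv⟩
  change ∑ u, (T.chainAction.symm c).1 u v.1 = 0
  simp only [chainAction_symm_apply]
  rw [Finset.sum_congr rfl fun w _ => T.edgeSign_mul w _ v.2 _
    (fun h => c.2.2 _ _ (fun h' => h ((T.edge_iff _ _).1 h'))), ← Finset.mul_sum]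
  have h1 := (T.F.toEquiv.sum_comp (fun w => c.1 w (T.F v.1))).trans h0
  exact (congrArg _ h1).trans (mul_zero _)

/-- The action of `εF` on the relative homology lattice `Λ`. -/
def latticeAction : T.homologyLattice ≃ₗ[ℤ] T.homologyLattice where
  toFun c := ⟨T.chainAction c.1, T.chainAction_mem c.1 c.2⟩
  invFun c := ⟨T.chainAction.symm c.1, T.chainAction_symm_mem c.1 c.2⟩
  map_add' a b := by ext1; simp
  map_smul' n a := by ext1; simp
  left_inv c := by ext1; simp
  right_inv c := by ext1; simp

theorem chainPairing_chainAction (c c' : T.relChains) :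
    T.chainPairing (T.chainAction c) (T.chainAction c') = T.chainPairing c c' := by
  classical
  simp only [MetrisedForestPair.chainPairing, LinearMap.mk₂_apply]
  rw [← T.F.mapEdgeSet.sum_comp]
  refine Finset.sum_congr rfl fun a _ => ?_
  rw [T.isometric]
  congr 1
  obtain ⟨x, hx⟩ := a
  induction x using Sym2.ind with
  | _ u v =>
    change (T.chainAction c).1 (T.F u) (T.F v) * (T.chainAction c').1 (T.F u) (T.F v) =
      c.1 u v * c'.1 u v
    simp only [chainAction_apply, RelIso.symm_apply_apply]
    rw [mul_mul_mul_comm, ← Units.val_mul, Int.units_mul_self, Units.val_one, one_mul]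

/-- The induced (contragredient) action of `εF` on `Λ^∨`: a functional `φ` is sent
to `φ ∘ (εF)⁻¹`. -/
def dualAction : Module.Dual ℤ T.homologyLattice →ₗ[ℤ] Module.Dual ℤ T.homologyLattice :=
  T.latticeAction.symm.toLinearMap.dualMap

theorem dualAction_toDual (c : T.homologyLattice) :
    T.dualAction (T.toDual c) = T.toDual (T.latticeAction c) := by
  ext c'
  have h := T.chainPairing_chainAction c.1 (T.latticeAction.symm c').1
  have h2 : T.chainAction (T.latticeAction.symm c').1 = c'.1 :=
    congrArg Subtype.val (T.latticeAction.apply_symm_apply c')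
  rw [h2] at h
  exact h.symm

/-- The induced action of `εF` on the geometric Néron component group `Λ^∨ / Λ`. -/
def componentAction : T.GeometricComponentGroup →ₗ[ℤ] T.GeometricComponentGroup :=
  Submodule.mapQ _ _ T.dualAction (by
    rintro _ ⟨c, rfl⟩
    exact ⟨T.latticeAction c, (T.dualAction_toDual c).symm⟩)

/-- The Néron component group of `T`: the `εF`-invariants of `Λ^∨ / Λ`. -/
def neronComponentGroup : Submodule ℤ T.GeometricComponentGroup :=
  LinearMap.eqLocus T.componentAction LinearMap.id

/-- The Tamagawa number of `T`: the order of its Néron component group. -/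
def tamagawaNumber : ℕ := Nat.card T.neronComponentGroup

end BYForest

end

/-! Write `L` for Λ, `N` for its dual, `ι : L → N` for the pairing map, `δ` and `D` for εF − 1 on
`L` and on `N`. Multiplying lengths by e replaces `ι` by `e • ι` and changes nothing else, so the
Tamagawa number is the index of e·ιL in its preimage under `D`. This index splits as [ker D :
e·ι(ker δ)] · [X e : δL], where X e = {x | e·ιx ∈ DN}.

The first factor is a constant times e^r, with r the rank of ker δ. For the second, every x in X e
is torsion modulo δL, and the crucial input is that such x satisfy 2ιx ∈ DN. Hence X e is X 2 for
even e and X 1 for odd e, and [X 2 : X 1] is a power of 2.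

The crucial input (`two_smul_toDual_mem_range`) holds because εF permutes the oriented edges up to
sign. On relative chains the coinvariants of a signed permutation are a sum of copies of ℤ and ℤ/2,
so 2 kills their torsion, and a chain pairs with Λ even when it is not a cycle. -/

/-! ### Indices in lattices with compatible endomorphisms -/

section IntegralLattices

variable {L N : Type*} [AddCommGroup L] [AddCommGroup N]

/-- The elements of `N` that `D` maps into the range of `ρ`, counted modulo that range. -/
theorem relIndex_range_comap (ρ : L →+ N) (hρ : Function.Injective ρ) (δ : L →+ L) (D : N →+ N)
    (h : ∀ x, D (ρ x) = ρ (δ x)) :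
    ρ.range.relIndex (ρ.range.comap D) =
      (δ.ker.map ρ).relIndex D.ker * δ.range.relIndex (D.range.comap ρ) := by
  have hδ : ρ.range.map D = δ.range.map ρ := by
    ext n
    simp [h]
  have hR : ρ.range ≤ ρ.range.comap D := by
    rintro _ ⟨x, rfl⟩
    exact ⟨δ x, (h x).symm⟩
  have hker : D.ker ≤ ρ.range.comap D := fun n hn =>
    ⟨0, by rw [map_zero, AddMonoidHom.mem_ker.1 hn]⟩
  have h1 : ρ.range ⊓ D.ker = δ.ker.map ρ := by
    ext n
    constructor
    · rintro ⟨⟨x, rfl⟩, hx⟩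
      refine ⟨x, hρ ?_, rfl⟩
      rw [← h, AddMonoidHom.mem_ker.1 hx, map_zero]
    · rintro ⟨x, hx, rfl⟩
      refine ⟨⟨x, rfl⟩, ?_⟩
      change D (ρ x) = 0
      rw [h, AddMonoidHom.mem_ker.1 hx, map_zero]
  -- Insert ker D + ρL between the two groups. The lower index is [ker D : ker D ∩ ρL], which `h1`
  -- identifies.
  rw [← AddSubgroup.relIndex_mul_relIndex _ (D.ker ⊔ ρ.range) _ le_sup_right (sup_le hker hR),
    AddSubgroup.relIndex_sup_right, ← AddSubgroup.inf_relIndex_right, h1]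
  congr 1
  -- Since ker D + ρL is the preimage of D(ρL), applying `D` turns the upper index into that of
  -- ρ(δL) in ρL ∩ DN, which is then pulled back along the injection `ρ`.
  rw [sup_comm, ← AddSubgroup.comap_map_eq, AddSubgroup.relIndex_comap, AddSubgroup.map_comap_eq,
    hδ, ← AddSubgroup.relIndex_map_map_of_injective _ _ hρ, AddSubgroup.map_comap_eq, inf_comm]

theorem relIndex_map_zsmul (K : Submodule ℤ L) [Module.Free ℤ K] [Module.Finite ℤ K]
    (n : ℕ) [NeZero n] :
    (K.map (LinearMap.lsmul ℤ L n)).toAddSubgroup.relIndex K.toAddSubgroup =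
      n ^ Module.finrank ℤ K := by
  rw [← ModN.natCard_eq]
  have : (K.map (LinearMap.lsmul ℤ L n)).toAddSubgroup.addSubgroupOf K.toAddSubgroup =
      (LinearMap.range (LinearMap.lsmul ℤ K n)).toAddSubgroup := by
    ext ⟨x, hx⟩
    constructor
    · rintro ⟨y, hy, hyx⟩
      exact ⟨⟨y, hy⟩, Subtype.ext hyx⟩
    · rintro ⟨y, hyx⟩
      exact ⟨y, y.2, congrArg Subtype.val hyx⟩
  rw [AddSubgroup.relIndex, this]
  rfl

theorem exists_relIndex_eq_two_pow (H K : AddSubgroup L) (h0 : H.relIndex K ≠ 0)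
    (h : ∀ x ∈ K, (2 : ℤ) • x ∈ H) : ∃ t, H.relIndex K = 2 ^ t := by
  have : Finite (K ⧸ H.addSubgroupOf K) := Nat.finite_of_card_ne_zero h0
  have hp : IsPGroup 2 (Multiplicative (K ⧸ H.addSubgroupOf K)) := by
    intro g
    refine ⟨1, ?_⟩
    obtain ⟨x, hx⟩ := QuotientAddGroup.mk_surjective g.toAdd
    apply Multiplicative.toAdd.injective
    rw [pow_one, toAdd_pow, ← hx, toAdd_one, ← QuotientAddGroup.mk_nsmul,
      QuotientAddGroup.eq_zero_iff, AddSubgroup.mem_addSubgroupOf]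
    have h2 := h x x.2
    rw [ofNat_zsmul] at h2
    exact h2
  obtain ⟨t, ht⟩ := hp.exists_card_eq
  exact ⟨t, ht⟩

variable [Module.Finite ℤ L]

/-- A finitely generated torsion group is finite. Nonvanishing matters because `relIndex` takes the
value 0 for infinite index. -/
theorem relIndex_ne_zero_of_zsmul_mem (H K : Submodule ℤ L)
    (h : ∀ x ∈ K, ∃ m : ℤ, m ≠ 0 ∧ m • x ∈ H) :
    H.toAddSubgroup.relIndex K.toAddSubgroup ≠ 0 := by
  have : Finite (K ⧸ H.submoduleOf K) := by
    refine Module.finite_of_fg_torsion _ fun q => ?_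
    obtain ⟨x, rfl⟩ := Submodule.Quotient.mk_surjective _ q
    obtain ⟨m, hm, hx⟩ := h x x.2
    refine ⟨⟨m, mem_nonZeroDivisors_of_ne_zero hm⟩, ?_⟩
    exact (Submodule.Quotient.mk_eq_zero _).2 hx
  exact (Nat.card_pos (α := K ⧸ H.submoduleOf K)).ne'

variable [Module.Free ℤ L]

/-- Growth of the invariants of `N / e L` for a pair of lattices `ι : L → N` with compatible
endomorphisms `δ`, `D`, when twice the torsion of `L / δ L` dies in `N / D N`. -/
theorem exists_relIndex_range_smul_eq (ι : L →ₗ[ℤ] N) (hι : Function.Injective ι)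
    (δ : L →ₗ[ℤ] L) (D : N →ₗ[ℤ] N) (h : ∀ x, D (ι x) = ι (δ x))
    [Module.Finite ℤ N] [Module.Free ℤ N] (k : ℤ) (hk : k ≠ 0) (hkι : ∀ n, k • n ∈ LinearMap.range ι)
    (h2 : ∀ (x y : L) (m : ℤ), 0 < m → m • x = δ y → (2 : ℤ) • ι x ∈ LinearMap.range D) :
    ∃ (a r t : ℕ), 0 < a ∧ ∀ e : ℕ+,
      (LinearMap.range ((e : ℤ) • ι)).toAddSubgroup.relIndex
        ((LinearMap.range ((e : ℤ) • ι)).comap D).toAddSubgroup =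
      a * (e : ℕ) ^ r * Nat.gcd e 2 ^ t := by
  set X : ℤ → Submodule ℤ L := fun e => (LinearMap.range D).comap (e • ι) with hX
  -- If e·ιx = Dn and kn = ιy, then ke·x = δy by injectivity of `ι`. The sign of `k` is then
  -- absorbed into `y` to make the multiplier positive.
  have htors : ∀ e : ℤ, 0 < e → ∀ x ∈ X e, ∃ (m : ℤ) (y : L), 0 < m ∧ m • x = δ y := by
    rintro e he x ⟨n, hn⟩
    obtain ⟨y, hy⟩ := hkι n
    have hm : (k * e) • x = δ y := hι (by
      rw [← h, hy, map_smul, map_smul, hn, mul_smul]; rfl)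
    rcases hk.lt_or_gt with hk | hk
    · exact ⟨-(k * e), -y, by nlinarith, by rw [neg_smul, hm, map_neg]⟩
    · exact ⟨k * e, y, by positivity, hm⟩
  have hX2 : ∀ e : ℤ, 0 < e → X e ≤ X 2 := fun e he x hx => by
    obtain ⟨m, y, hm, hxy⟩ := htors e he x hx
    exact h2 x y m hm hxy
  have hX12 : X 1 ≤ X 2 := hX2 1 one_pos
  have hδX : LinearMap.range δ ≤ X 1 := by
    rintro _ ⟨y, rfl⟩
    exact ⟨ι y, by rw [one_smul, h]⟩
  have heven : ∀ e : ℤ, 0 < e → Even e → X e = X 2 := by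
    rintro e he ⟨c, hc⟩
    refine le_antisymm (hX2 e he) ?_
    rintro x ⟨n, hn⟩
    refine ⟨c • n, ?_⟩
    rw [map_smul, hn, hc, LinearMap.smul_apply, LinearMap.smul_apply, smul_smul, mul_two]
  have hodd : ∀ e : ℤ, 0 < e → Odd e → X e = X 1 := by
    rintro e he ⟨c, hc⟩
    -- For e = 2c + 1 and x in X 2, e·ιx and ιx agree modulo DN.
    have h1 : ∀ x ∈ X 2, ((e • ι) x ∈ LinearMap.range D ↔ ι x ∈ LinearMap.range D) := by
      rintro x hx
      have : (e • ι) x = c • ((2 : ℤ) • ι) x + ι x := by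
        rw [hc, LinearMap.smul_apply, LinearMap.smul_apply, add_smul, one_smul, smul_smul, mul_comm]
      rw [this]
      exact Submodule.add_mem_iff_right _ (Submodule.smul_mem _ _ hx)
    ext x
    constructor
    · intro hx
      simpa [hX] using (h1 x (hX2 e he hx)).1 hx
    · intro hx
      exact (h1 x (hX12 hx)).2 (by simpa [hX] using hx)
  obtain ⟨t, ht⟩ := exists_relIndex_eq_two_pow (X 1).toAddSubgroup (X 2).toAddSubgroup
    (relIndex_ne_zero_of_zsmul_mem _ _ fun x hx => by
      obtain ⟨m, y, hm, hxy⟩ := htors 2 two_pos x hx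
      exact ⟨m, hm.ne', hδX ⟨y, hxy.symm⟩⟩)
    (fun x hx => by
      change ((1 : ℤ) • ι) ((2 : ℤ) • x) ∈ LinearMap.range D
      rw [one_smul, map_smul]
      exact hx)
  set K := LinearMap.ker δ
  have hKle : K.map ι ≤ LinearMap.ker D := by
    rintro _ ⟨x, hx, rfl⟩
    rw [LinearMap.mem_ker, h, LinearMap.mem_ker.1 hx, map_zero]
  -- The constant `a` is the value of the index at e = 1; both of its factors are finite because `k`
  -- kills N/ιL and X 1 is torsion modulo δL.
  refine ⟨(K.map ι).toAddSubgroup.relIndex (LinearMap.ker D).toAddSubgroup *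
    (LinearMap.range δ).toAddSubgroup.relIndex (X 1).toAddSubgroup, Module.finrank ℤ K, t, ?_, ?_⟩
  · refine Nat.pos_of_ne_zero (mul_ne_zero ?_ ?_)
    · refine relIndex_ne_zero_of_zsmul_mem _ _ fun n hn => ⟨k, hk, ?_⟩
      obtain ⟨x, hx⟩ := hkι n
      refine ⟨x, hι ?_, hx⟩
      rw [← h, hx, map_smul, LinearMap.mem_ker.1 hn, smul_zero, map_zero]
    · refine relIndex_ne_zero_of_zsmul_mem _ _ fun x hx => ?_
      obtain ⟨m, y, hm, hxy⟩ := htors 1 one_pos x hx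
      exact ⟨m, hm.ne', y, hxy.symm⟩
  intro e
  have he : (0 : ℤ) < (e : ℕ) := by exact_mod_cast e.pos
  have hmain := relIndex_range_comap ((e : ℤ) • ι).toAddMonoidHom
    (fun x y hxy => hι (smul_right_injective N he.ne' hxy)) δ.toAddMonoidHom D.toAddMonoidHom
    (fun x => by
      change D ((e : ℤ) • ι x) = (e : ℤ) • ι (δ x)
      rw [map_smul, h])
  refine hmain.trans ?_
  -- The chain e·ιK ≤ ιK ≤ ker D has lower index e^r, by injectivity of `ι`.
  have h1 : ((δ.toAddMonoidHom.ker).map ((e : ℤ) • ι).toAddMonoidHom).relIndex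
      D.toAddMonoidHom.ker =
      (e : ℕ) ^ Module.finrank ℤ K *
        (K.map ι).toAddSubgroup.relIndex (LinearMap.ker D).toAddSubgroup := by
    have : (δ.toAddMonoidHom.ker).map ((e : ℤ) • ι).toAddMonoidHom =
        ((K.map (LinearMap.lsmul ℤ L (e : ℕ))).toAddSubgroup).map ι.toAddMonoidHom := by
      ext n
      constructor
      · rintro ⟨x, hx, rfl⟩
        exact ⟨_, ⟨x, hx, rfl⟩, ι.map_smul _ _⟩
      · rintro ⟨_, ⟨x, hx, rfl⟩, rfl⟩
        exact ⟨x, hx, (ι.map_smul _ _).symm⟩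
    have hle : K.map (LinearMap.lsmul ℤ L (e : ℕ)) ≤ K := by
      rintro _ ⟨x, hx, rfl⟩
      exact K.smul_mem _ hx
    have hmap : (K.map ι).toAddSubgroup = K.toAddSubgroup.map ι.toAddMonoidHom := rfl
    rw [this, ← relIndex_map_zsmul, hmap, ← AddSubgroup.relIndex_map_map_of_injective
      (f := ι.toAddMonoidHom) _ K.toAddSubgroup hι]
    exact (AddSubgroup.relIndex_mul_relIndex _ _ _ (AddSubgroup.map_mono hle) hKle).symm
  have h3 : (LinearMap.range δ).toAddSubgroup.relIndex (X e).toAddSubgroup =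
      (LinearMap.range δ).toAddSubgroup.relIndex (X 1).toAddSubgroup * Nat.gcd e 2 ^ t := by
    rcases Nat.even_or_odd (e : ℕ) with hev | hod
    · rw [heven e he (by exact_mod_cast hev), Nat.gcd_eq_right hev.two_dvd, ← ht]
      exact (AddSubgroup.relIndex_mul_relIndex _ _ _ hδX hX12).symm
    · rw [hodd e he (by exact_mod_cast hod), (Nat.coprime_two_right.2 hod : Nat.gcd e 2 = 1),
        one_pow, mul_one]
  exact (congrArg₂ (· * ·) h1 h3).trans (by ring)

end IntegralLattices

/-! ### Nondegeneracy of the length pairing -/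

namespace MetrisedForestPair

variable {V : Type*} [Fintype V] (P : MetrisedForestPair V)

theorem chainPairing_self_eq_zero {c : P.relChains} (h : P.chainPairing c c = 0) : c = 0 := by
  classical
  simp only [chainPairing, LinearMap.mk₂_apply] at h
  have hnn : ∀ a : P.graph.edgeSet, 0 ≤ ((P.length a : ℕ) : ℤ) * P.edgeProduct c c a.1 := by
    rintro ⟨x, hx⟩
    induction x using Sym2.ind with
    | _ u v => exact mul_nonneg (Int.natCast_nonneg _) (mul_self_nonneg (c.1 u v))
  rw [Finset.sum_eq_zero_iff_of_nonneg fun a _ => hnn a] at h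
  ext u v
  by_cases huv : P.graph.Adj u v
  · have := h ⟨s(u, v), huv⟩ (Finset.mem_univ _)
    rcases mul_eq_zero.1 this with h0 | h0
    · exact absurd h0 (by exact_mod_cast (P.length _).ne_zero)
    · exact mul_self_eq_zero.1 h0
  · exact c.2.2 u v fun h' => huv h'.1

theorem toDual_injective : Function.Injective P.toDual := by
  rw [injective_iff_map_eq_zero]
  intro c hc
  exact Subtype.ext (P.chainPairing_self_eq_zero (LinearMap.congr_fun hc c))

/-- The pairing is definite, so Λ embeds in its dual with equal rank and finite cokernel; the order
of the cokernel serves as `k`. -/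
theorem exists_smul_mem_range_toDual :
    ∃ k : ℤ, k ≠ 0 ∧ ∀ n, k • n ∈ LinearMap.range P.toDual := by
  have : Finite P.GeometricComponentGroup := Submodule.finiteQuotientOfFreeOfRankEq _ (by
    rw [LinearMap.finrank_range_of_inj P.toDual_injective]
    exact (Module.finrank_linearMap_self ℤ ℤ P.homologyLattice).symm)
  refine ⟨Nat.card P.GeometricComponentGroup, by exact_mod_cast Nat.card_pos.ne', fun n => ?_⟩
  rw [← Submodule.Quotient.mk_eq_zero, Submodule.Quotient.mk_smul, natCast_zsmul,
    card_nsmul_eq_zero']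

end MetrisedForestPair

/-! ### Signed permutations of chains, scaling and the Tamagawa number -/

namespace BYForest

variable {V : Type*} (T : BYForest V)

/-- The torsion of the coinvariants of `εF` on relative chains is killed by `2`, since `εF` acts by
signed permutations of the edges. -/
theorem exists_two_smul_eq_chainAction_sub (x y : T.relChains) (m : ℤ) (hm : 0 < m)
    (h : m • x = T.chainAction y - y) : ∃ c, (2 : ℤ) • x = T.chainAction c - c := by
  -- Apply to each coefficient f(z) = ⌊z/m⌋ + ⌈z/m⌉, the ceiling being written −⌊−z/m⌋. It is odd,
  -- so it preserves alternating chains and commutes with εF, and f(z + mx) = f(z) + 2x. A floor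
  -- alone would not be odd; this is the source of the 2.
  refine ⟨⟨fun u v => y.1 u v / m - (- y.1 u v) / m, fun u v => ?_, fun u v huv => ?_⟩, ?_⟩
  · dsimp only
    rw [y.2.1 u v, neg_neg, neg_sub]
  · dsimp only
    rw [y.2.2 u v huv]
    simp
  ext u v
  have hxy : m * x.1 u v = (T.edgeSign (T.F.symm u) (T.F.symm v) : ℤ) *
      y.1 (T.F.symm u) (T.F.symm v) - y.1 u v :=
    congrFun (congrFun (congrArg Subtype.val h) u) v
  change 2 * x.1 u v = (T.edgeSign (T.F.symm u) (T.F.symm v) : ℤ) *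
      (y.1 (T.F.symm u) (T.F.symm v) / m - (- y.1 (T.F.symm u) (T.F.symm v)) / m) -
      (y.1 u v / m - (- y.1 u v) / m)
  generalize y.1 (T.F.symm u) (T.F.symm v) = z at *
  have hodd : (T.edgeSign (T.F.symm u) (T.F.symm v) : ℤ) * (z / m - (-z) / m) =
      ((T.edgeSign (T.F.symm u) (T.F.symm v) : ℤ) * z) / m -
        (-((T.edgeSign (T.F.symm u) (T.F.symm v) : ℤ) * z)) / m := by
    rcases Int.units_eq_one_or (T.edgeSign (T.F.symm u) (T.F.symm v)) with h | h <;> simp [h]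
  rw [hodd, show (T.edgeSign (T.F.symm u) (T.F.symm v) : ℤ) * z = y.1 u v + m * x.1 u v by
    rw [hxy]; ring, neg_add, ← mul_neg, Int.add_mul_ediv_left _ _ hm.ne',
    Int.add_mul_ediv_left _ _ hm.ne']
  ring

theorem walkLength_scale (e : ℕ+) {u v : V} (p : T.graph.Walk u v) :
    (T.scale e).walkLength p = e * T.walkLength p := by
  simp only [MetrisedForestPair.walkLength, scale, PNat.mul_coe, List.sum_map_mul_left]

theorem ParityA.scale {T : BYForest V} (h : T.ParityA) (e : ℕ+) : (T.scale e).ParityA :=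
  fun u v p hp hodd => h u v p hp
    (Nat.odd_mul.1 (T.walkLength_scale e p ▸ hodd : Odd ((e : ℕ) * T.walkLength p))).2

theorem ParityB.scale {T : BYForest V} (h : T.ParityB) (e : ℕ+) : (T.scale e).ParityB :=
  fun n u v huv hodd => h n u v huv
    (Nat.odd_mul.1 (by simpa [BYForest.scale] using hodd :
      Odd ((e : ℕ) * (T.length ⟨s(u, v), huv⟩ : ℕ)))).2

variable [Fintype V]

/-- A class in Λ^∨/Λ is fixed exactly when εF − 1 sends a representative into the image of Λ. -/
theorem tamagawaNumber_eq_relIndex :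
    T.tamagawaNumber = (LinearMap.range T.toDual).toAddSubgroup.relIndex
      ((LinearMap.range T.toDual).comap (T.dualAction - LinearMap.id)).toAddSubgroup := by
  have h : T.neronComponentGroup.toAddSubgroup =
      ((LinearMap.range T.toDual).comap (T.dualAction - LinearMap.id)).toAddSubgroup.map
        (QuotientAddGroup.mk' (LinearMap.range T.toDual).toAddSubgroup) := by
    have key : ∀ n, Submodule.Quotient.mk n ∈ T.neronComponentGroup ↔
        n ∈ (LinearMap.range T.toDual).comap (T.dualAction - LinearMap.id) := fun n =>
      Submodule.Quotient.eq _
    ext q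
    constructor
    · intro hq
      obtain ⟨n, rfl⟩ := Submodule.Quotient.mk_surjective _ q
      exact ⟨n, (key n).1 hq, rfl⟩
    · rintro ⟨n, hn, rfl⟩
      exact (key n).2 hn
  have h2 := AddSubgroup.relIndex_ker (QuotientAddGroup.mk' (LinearMap.range T.toDual).toAddSubgroup)
    (K := ((LinearMap.range T.toDual).comap (T.dualAction - LinearMap.id)).toAddSubgroup)
  rw [QuotientAddGroup.ker_mk', ← h] at h2
  exact h2.symm

theorem toDual_scale (e : ℕ+) : (T.scale e).toDual = (e : ℤ) • T.toDual := by
  ext c c'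
  change (T.scale e).chainPairing c.1 c'.1 = (e : ℤ) * T.chainPairing c.1 c'.1
  simp only [MetrisedForestPair.chainPairing, LinearMap.mk₂_apply]
  refine (Finset.sum_congr rfl fun a _ => ?_).trans (Finset.mul_sum _ _ _).symm
  change (((e * T.length a : ℕ+) : ℕ) : ℤ) * T.edgeProduct c.1 c'.1 a.1 = _
  rw [PNat.mul_coe, Nat.cast_mul, mul_assoc]

/-- Solving 2x = (εF − 1)c is possible among chains, with `c` not necessarily a cycle. Its pairing
is nevertheless a functional on Λ, and invariance of the pairing carries the equation over to the
dual. Hence the conclusion concerns Λ^∨ and not Λ. -/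
theorem two_smul_toDual_mem_range (x y : T.homologyLattice) (m : ℤ) (hm : 0 < m)
    (h : m • x = T.latticeAction y - y) :
    (2 : ℤ) • T.toDual x ∈ LinearMap.range (T.dualAction - LinearMap.id) := by
  obtain ⟨c, hc⟩ := T.exists_two_smul_eq_chainAction_sub x.1 y.1 m hm (congrArg Subtype.val h)
  refine ⟨(T.chainPairing c).domRestrict T.homologyLattice, ?_⟩
  ext z
  have hz : T.chainAction (T.latticeAction.symm z).1 = z.1 :=
    congrArg Subtype.val (T.latticeAction.apply_symm_apply z)
  have h1 := T.chainPairing_chainAction c (T.latticeAction.symm z).1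
  rw [hz] at h1
  change T.chainPairing c (T.latticeAction.symm z).1 - T.chainPairing c z.1 =
    (2 : ℤ) * T.chainPairing x.1 z.1
  rw [← h1, ← smul_eq_mul, ← LinearMap.smul_apply, ← map_smul, hc, map_sub, LinearMap.sub_apply]

end BYForest

theorem mainTheorem10 {V : Type*} [Fintype V] (T : BYForest V)
    (hA : T.ParityA) (hB : T.ParityB) :
    (∀ e : ℕ+, (T.scale e).ParityA ∧ (T.scale e).ParityB) ∧
    ∃ (a : ℕ) (r : ℕ) (s : ℤ), 0 < a ∧ ∀ e : ℕ+,
      ((T.scale e).tamagawaNumber : ℚ) =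
        (a : ℚ) * ((e : ℕ) : ℚ) ^ r * ((Nat.gcd (e : ℕ) 2 : ℕ) : ℚ) ^ s := by
  refine ⟨fun e => ⟨hA.scale e, hB.scale e⟩, ?_⟩
  obtain ⟨k, hk, hkι⟩ := T.exists_smul_mem_range_toDual
  obtain ⟨a, r, t, ha, h⟩ := exists_relIndex_range_smul_eq T.toDual T.toDual_injective
    (T.latticeAction.toLinearMap - LinearMap.id) (T.dualAction - LinearMap.id)
    (fun x => by simp [BYForest.dualAction_toDual]) k hk hkι T.two_smul_toDual_mem_range
  refine ⟨a, r, t, ha, fun e => ?_⟩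
  have he : (T.scale e).tamagawaNumber = a * (e : ℕ) ^ r * Nat.gcd e 2 ^ t := by
    rw [BYForest.tamagawaNumber_eq_relIndex, BYForest.toDual_scale]
    -- Scaling leaves Λ and the action of εF on Λ^∨ definitionally unchanged.
    exact h e
  rw [he, zpow_natCast]
  push_cast
  rfl
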